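/- A \emph{filtered graph} $G$ is a finite graph in the sense of Serre with edges $E_1,\dots,E_m$ (one oriented edge chosen from each pair of mutually inverse edges) and the filtration $\emptyset=G_0\subseteq G_1\subseteq\dots\subseteq G_m=G$, where $G_r$ is the subgraph generated by $E_1,\dots,E_r$; the subgraphs $G_r$ (and $G$) need not be connected. Paths are edge paths, i.e. finite composable sequences of oriented edges, including the trivial path at each vertex; $\overline{\alpha}$ is the inverse of the path $\alpha$, and $\simeq$ denotes homotopy of paths relative to the end points. The \emph{height} $ht(\alpha)$ of a path $\alpha$ is the largest $r$ such that $E_r$ or $\overline{E_r}$ occurs in $\alpha$ (and $0$ if $\alpha$ is trivial). A map $f:G\to G$ sending vertices to vertices and edges to edge paths is \emph{upper triangular} if, for each $i$, $f(E_i)=E_iu_i$, where $u_i$ is a (possibly trivial) loop at the terminal vertex of $E_i$ all of whose edges lie in $G_{i-1}$. Such a map fixes every vertex that is an end point of an edge. \textbf{Theorem.} Let $f,g$ be upper triangular maps on a filtered graph $G$. Let $\alpha_1,\alpha_2$ be loops based at a vertex $v$ of $G$ whose classes generate a free group of rank $2$ in $\pi_1(G,v)$. Suppose that $\mu,\nu$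 are paths such that $f(\alpha_i)\simeq\mu\alpha_i\overline{\mu}$ and $g(\alpha_i)\simeq\nu\alpha_i\overline{\nu}$ for $i=1,2$. Then there exists a path $\delta$ in $G$, ending at $v$, such that $$f(\delta)\simeq\delta\overline{\mu},\qquad g(\delta)\simeq\delta\overline{\nu},\qquad ht(\delta)\le\max\{ht(\alpha_1),ht(\alpha_2)\}.$$ -/

import Mathlib

/-- A finite graph in the sense of Serre, together with a filtration by subgraphs
`∅ = G₀ ⊆ G₁ ⊆ … ⊆ G_m = G`, each obtained from the previous one by adding a single edge, and a
preferred orientation of every edge. This amounts to a list of oriented edges `E₁, …, E_m`, one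
from each pair of mutually inverse edges, with initial and terminal vertices; `E_{i+1}` has index
`i : Fin m`, and `G_r` consists of the edges of index `< r`. The graph need not be connected. -/
structure FilteredGraph (V : Type*) (m : ℕ) where
  /-- the initial vertex of an edge, in its preferred orientation -/
  init : Fin m → V
  /-- the terminal vertex of an edge, in its preferred orientation -/
  term : Fin m → V

namespace FilteredGraph

variable {V : Type*} {m : ℕ}

/-- The oriented edges are the pairs `(i, b)`: `(i, true)` is the edge with its preferred
orientation, `(i, false)` the same edge with the reversed one. This is the initial vertex. -/
def src (G : FilteredGraph V m) (e : Fin m × Bool) : V :=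
  if e.2 then G.init e.1 else G.term e.1

/-- The terminal vertex of an oriented edge. -/
def tgt (G : FilteredGraph V m) (e : Fin m × Bool) : V :=
  if e.2 then G.term e.1 else G.init e.1

/-- The sequence of oriented edges `p` is an edge path from `u` to `w`; the empty sequence is the
trivial path at each vertex. -/
def IsPath (G : FilteredGraph V m) : V → List (Fin m × Bool) → V → Prop
  | u, [], w => u = w
  | u, e :: p, w => G.src e = u ∧ G.IsPath (G.tgt e) p w

theorem isPath_append {G : FilteredGraph V m} {u v w : V} {p q : List (Fin m × Bool)}
    (hp : G.IsPath u p v) (hq : G.IsPath v q w) : G.IsPath u (p ++ q) w := by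
  induction p generalizing u with
  | nil => cases hp; exact hq
  | cons e p ih => exact ⟨hp.1, ih hp.2⟩

theorem isPath_invRev {G : FilteredGraph V m} {u w : V} {p : List (Fin m × Bool)}
    (hp : G.IsPath u p w) : G.IsPath w (FreeGroup.invRev p) u := by
  induction p generalizing u with
  | nil => exact (show u = w from hp).symm
  | cons e p ih =>
    have h : FreeGroup.invRev (e :: p) = FreeGroup.invRev p ++ [(e.1, !e.2)] := by
      simp [FreeGroup.invRev]
    rw [h]
    refine isPath_append (ih hp.2) ?_
    obtain ⟨i, b⟩ := e
    obtain ⟨h1, -⟩ := hp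
    cases b <;> exact ⟨rfl, h1⟩

/-- Edge paths from `u` to `w`. -/
@[ext] structure Path (G : FilteredGraph V m) (u w : V) where
  /-- the sequence of oriented edges -/
  edges : List (Fin m × Bool)
  isPath : G.IsPath u edges w

namespace Path

variable {G : FilteredGraph V m} {u v w : V}

/-- The trivial path at a vertex. -/
def nil (u : V) : G.Path u u := ⟨[], rfl⟩

/-- Concatenation of paths. -/
def append (p : G.Path u v) (q : G.Path v w) : G.Path u w :=
  ⟨p.edges ++ q.edges, isPath_append p.isPath q.isPath⟩

/-- The inverse path: the inverse edges in the opposite order. -/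
def reverse (p : G.Path u w) : G.Path w u :=
  ⟨FreeGroup.invRev p.edges, isPath_invRev p.isPath⟩

/-- Transport of a path along equalities of its end points. -/
def copy {u' w' : V} (p : G.Path u w) (hu : u = u') (hw : w = w') : G.Path u' w' :=
  ⟨p.edges, by subst hu; subst hw; exact p.isPath⟩

/-- The height of a path: the largest `r` such that the `r`-th edge (counted from `1`) occurs in it
in either orientation, and `0` for a trivial path. -/
def height (p : G.Path u w) : ℕ :=
  (p.edges.map fun e => (e.1 : ℕ) + 1).foldr max 0

/-- Homotopy of paths relative to their end points: the equivalence relation on the edge paths from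
`u` to `w` generated by deleting a pair of adjacent mutually inverse edges. -/
def Homotopic : G.Path u w → G.Path u w → Prop :=
  Relation.EqvGen fun p q => FreeGroup.Red.Step p.edges q.edges

theorem Homotopic.append_left (p : G.Path u v) {q q' : G.Path v w} (h : q.Homotopic q') :
    (p.append q).Homotopic (p.append q') := by
  induction h with
  | rel _ _ h => exact .rel _ _ (FreeGroup.Red.Step.append_left h)
  | refl _ => exact .refl _
  | symm _ _ _ ih => exact .symm _ _ ih
  | trans _ _ _ _ _ ih ih' => exact .trans _ _ _ ih ih'

theorem Homotopic.append_right {p p' : G.Path u v} (h : p.Homotopic p') (q : G.Path v w) :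
    (p.append q).Homotopic (p'.append q) := by
  induction h with
  | rel _ _ h => exact .rel _ _ (FreeGroup.Red.Step.append_right h)
  | refl _ => exact .refl _
  | symm _ _ _ ih => exact .symm _ _ ih
  | trans _ _ _ _ _ ih ih' => exact .trans _ _ _ ih ih'

theorem Homotopic.reverse {p p' : G.Path u w} (h : p.Homotopic p') :
    p.reverse.Homotopic p'.reverse := by
  induction h with
  | rel _ _ h => exact .rel _ _ (FreeGroup.Red.Step.invRev h)
  | refl _ => exact .refl _
  | symm _ _ _ ih => exact .symm _ _ ih
  | trans _ _ _ _ _ ih ih' => exact .trans _ _ _ ih ih'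

theorem reverse_append_self (p : G.Path u w) : (p.reverse.append p).Homotopic (nil w) := by
  obtain ⟨l, hl⟩ := p
  induction l generalizing u with
  | nil => cases hl; exact .refl _
  | cons e l ih =>
    refine .trans _ _ _ (.rel _ _ ?_) (ih hl.2)
    have h : FreeGroup.invRev (e :: l) ++ e :: l
        = FreeGroup.invRev l ++ (e.1, !e.2) :: (e.1, !!e.2) :: l := by
      simp [FreeGroup.invRev]
    change FreeGroup.Red.Step (FreeGroup.invRev (e :: l) ++ e :: l) (FreeGroup.invRev l ++ l)
    rw [h]
    exact FreeGroup.Red.Step.not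

/-- The paths from `u` to `w` up to homotopy relative to the end points. -/
def setoid (G : FilteredGraph V m) (u w : V) : Setoid (G.Path u w) :=
  ⟨Homotopic, Relation.EqvGen.is_equivalence _⟩

end Path

/-- The fundamental group of `G` at `v`: homotopy classes of loops at `v`. -/
def FundamentalGroup (G : FilteredGraph V m) (v : V) : Type :=
  Quotient (Path.setoid G v v)

namespace FundamentalGroup

variable {G : FilteredGraph V m} {v : V}

/-- The class of a loop in the fundamental group. -/
def mk (p : G.Path v v) : G.FundamentalGroup v := Quotient.mk (Path.setoid G v v) p

instance : Group (G.FundamentalGroup v) where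
  mul := Quotient.map₂ Path.append fun _ _ h _ _ h' =>
    .trans _ _ _ (Path.Homotopic.append_right h _) (Path.Homotopic.append_left _ h')
  one := mk (Path.nil v)
  inv := Quotient.map Path.reverse fun _ _ h => Path.Homotopic.reverse h
  mul_assoc := by
    rintro ⟨a⟩ ⟨b⟩ ⟨c⟩
    exact congrArg mk (Path.ext (List.append_assoc _ _ _))
  one_mul := by
    rintro ⟨a⟩
    exact congrArg mk (Path.ext (List.nil_append _))
  mul_one := by
    rintro ⟨a⟩
    exact congrArg mk (Path.ext (List.append_nil _))
  inv_mul_cancel := by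
    rintro ⟨a⟩
    exact Quotient.sound (s := Path.setoid G v v) (Path.reverse_append_self a)

end FundamentalGroup

/-- A map from `G` to itself which sends vertices to vertices and edges to edge paths. -/
structure Map (G : FilteredGraph V m) where
  /-- the map on vertices -/
  vert : V → V
  /-- the image of an edge with its preferred orientation -/
  edge : ∀ i : Fin m, G.Path (vert (G.init i)) (vert (G.term i))

namespace Map

variable {G : FilteredGraph V m}

/-- The image of an oriented edge, as a sequence of edges. -/
def orientedEdge (f : G.Map) (e : Fin m × Bool) : List (Fin m × Bool) :=
  if e.2 then (f.edge e.1).edges else (f.edge e.1).reverse.edges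

theorem isPath_flatMap (f : G.Map) {u w : V} {p : List (Fin m × Bool)} (hp : G.IsPath u p w) :
    G.IsPath (f.vert u) (p.flatMap f.orientedEdge) (f.vert w) := by
  induction p generalizing u with
  | nil => exact congrArg f.vert hp
  | cons e p ih =>
    rw [List.flatMap_cons]
    refine isPath_append (v := f.vert (G.tgt e)) ?_ (ih hp.2)
    obtain ⟨i, b⟩ := e
    obtain ⟨rfl, -⟩ := hp
    cases b
    · exact (f.edge i).reverse.isPath
    · exact (f.edge i).isPath

/-- The image of an edge path under a map. -/
def mapPath (f : G.Map) {u w : V} (p : G.Path u w) : G.Path (f.vert u) (f.vert w) :=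
  ⟨p.edges.flatMap f.orientedEdge, isPath_flatMap f p.isPath⟩

/-- A map `f` is upper triangular if, for each `i`, the path `f(E_i)` is `E_i u_i` for a (possibly
trivial) loop `u_i` at the terminal vertex of `E_i` all of whose edges precede `E_i`. -/
def IsUpperTriangular (f : G.Map) : Prop :=
  ∀ i : Fin m, ∃ u : G.Path (G.term i) (G.term i),
    (∀ e ∈ u.edges, e.1 < i) ∧ (f.edge i).edges = (i, true) :: u.edges

end Map

end FilteredGraph

/-! Homotopy classes of paths embed in the free group on the edges, where `f` becomes an
endomorphism `φ` multiplying each generator on the right by a word in earlier ones. With `b` the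
inverse class of `μ`, the hypothesis reads `b * φ α = α * b`, so the affine map `y ↦ b * φ y`
commutes with left translation by both loops; for `x = δ⁻¹` the conclusion reads `b * φ x = x`.
Wanted is a common fixed point of two such maps (`exists_common_fixed`).

The proof is by induction on the height. Let `L` be generated by the first `r` edges and let `e` be
the next one. The group generated by `L` and `e` acts on a tree with vertices `yL` and one edge from
`xL` to `xeL` for each element `x`; the affine maps are isometries of it. If the first loop is
hyperbolic, an isometry commuting with it preserves its axis. It cannot translate along the axis,
for its centralizer would then act on that line freely on edges and be abelian, but the loops do not
commute. So both maps fix an edge of the axis (`apply_eq_self`). If the first loop fixes a vertex,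
conjugate that vertex to `L`; then both affine maps fix `L` (`mem_lower_of_conj_of_mem_succ`).
Either the second loop lies in `L` too, and induction applies, or both maps fix the first edge from
`L` to its translate by the second loop (`apply_eq_of_first_edge`). -/

theorem Nat.injective_of_forall_lt_ne {β : Type*} {s : ℕ → β} (h : ∀ n k, n < k → s n ≠ s k) :
    Function.Injective s := fun n k hnk => by
  rcases lt_trichotomy n k with hlt | heq | hlt
  · exact absurd hnk (h _ _ hlt)
  · exact heq
  · exact absurd hnk.symm (h _ _ hlt)

/-! ### Half-spaces in a tree and their isometries -/

/-- A half-space of a group acting on a tree with one orbit of distinguished edges, freely: the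
elements of the group are the distinguished edges, and the translates `x • P` of the set `P` of
elements beyond the edge `1` are the half-spaces beyond the other edges. -/
structure HalfSpace (A : Type*) [Group A] where
  /-- the elements beyond the distinguished edge -/
  carrier : Set A
  one_notMem : (1 : A) ∉ carrier
  nonempty : carrier.Nonempty
  -- The tree axiom: if edge `1` separates `z` from `p`, then edge `z` does not separate `1` from
  -- `p`.
  inv_mul_mem : ∀ {z p : A}, z ≠ 1 → ¬(z ∈ carrier ↔ p ∈ carrier) →
    (z⁻¹ * p ∈ carrier ↔ z⁻¹ ∈ carrier)
  finite_separating : ∀ p q : A, {x : A | ¬(x⁻¹ * p ∈ carrier ↔ x⁻¹ * q ∈ carrier)}.Finite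
  /-- the length of an element -/
  length : A → ℕ
  length_mul : ∀ {z w : A}, z⁻¹ ∉ carrier → w ∈ carrier →
    length (z * w) = length z + length w
  eq_one_of_length : ∀ {z : A}, length z = 0 → z = 1

namespace HalfSpace

variable {A : Type*} [Group A] (P : HalfSpace A)

/-- The translate of the half-space by `z` is strictly contained in it. -/
def Pos (z : A) : Prop := z ∈ P.carrier ∧ z⁻¹ ∉ P.carrier

/-- A permutation which respects the relative position of half-spaces. -/
def IsIsometry (F : Equiv.Perm A) : Prop :=
  ∀ x y : A, (F x)⁻¹ * F y ∈ P.carrier ↔ x⁻¹ * y ∈ P.carrier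

variable {P}

theorem Pos.ne_one {z : A} (hz : P.Pos z) : z ≠ 1 := by
  rintro rfl
  exact P.one_notMem hz.1

theorem Pos.inv_ne_one {z : A} (hz : P.Pos z) : z⁻¹ ≠ 1 :=
  _root_.inv_ne_one.2 hz.ne_one

theorem Pos.mem_of_inv_mul_mem {z p : A} (hz : P.Pos z) (h : z⁻¹ * p ∈ P.carrier) :
    p ∈ P.carrier := by
  by_contra hp
  exact hz.2 ((P.inv_mul_mem hz.ne_one (by simp [hz.1, hp])).1 h)

theorem Pos.mul_mem {z w : A} (hz : P.Pos z) (hw : w ∈ P.carrier) : z * w ∈ P.carrier := by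
  have h := P.inv_mul_mem (z := z⁻¹) (p := w) hz.inv_ne_one (by simp [hz.2, hw])
  rw [inv_inv] at h
  exact h.2 hz.1

theorem Pos.mul {z w : A} (hz : P.Pos z) (hw : P.Pos w) : P.Pos (z * w) := by
  refine ⟨hz.mul_mem hw.1, fun h => ?_⟩
  rw [mul_inv_rev] at h
  exact hz.2 (hw.mem_of_inv_mul_mem h)

/-- The two products have equal length, while a positive quotient would add its own length to one of
them; so the quotient has length zero. -/
theorem commute_of_pos {z w : A} (hz : P.Pos z) (hw : P.Pos w)
    (h : (z * w)⁻¹ * (w * z) = 1 ∨ P.Pos ((z * w)⁻¹ * (w * z)) ∨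
      P.Pos ((z * w)⁻¹ * (w * z))⁻¹) : z * w = w * z := by
  have key : ∀ {a b : A}, P.Pos a → P.Pos b → P.Pos ((a * b)⁻¹ * (b * a)) → a * b = b * a := by
    intro a b ha hb hab
    have h1 := P.length_mul (ha.mul hb).2 hab.1
    rw [mul_inv_cancel_left, P.length_mul ha.2 hb.1, P.length_mul hb.2 ha.1] at h1
    have h2 := P.eq_one_of_length (z := (a * b)⁻¹ * (b * a)) (by omega)
    exact inv_mul_eq_one.1 h2
  rcases h with h | h | h
  · exact inv_mul_eq_one.1 h
  · exact key hz hw h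
  · refine (key hw hz ?_).symm
    simpa [mul_assoc] using h

/-- A subgroup on which the half-spaces are linearly ordered is commutative. -/
theorem commute_of_subgroup {K : Subgroup A}
    (hK : ∀ k ∈ K, k = 1 ∨ P.Pos k ∨ P.Pos k⁻¹) {z w : A} (hz : z ∈ K) (hw : w ∈ K) :
    Commute z w := by
  have key : ∀ {a b : A}, a ∈ K → b ∈ K → P.Pos a → P.Pos b → Commute a b := fun ha hb ha' hb' =>
    commute_of_pos ha' hb' (hK _ (K.mul_mem (K.inv_mem (K.mul_mem ha hb)) (K.mul_mem hb ha)))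
  rcases hK z hz with rfl | hz' | hz'
  · exact Commute.one_left w
  all_goals rcases hK w hw with rfl | hw' | hw'
  · exact Commute.one_right z
  · exact key hz hw hz' hw'
  · exact Commute.inv_right_iff.1 (key hz (K.inv_mem hw) hz' hw')
  · exact Commute.one_right z
  · exact Commute.inv_left_iff.1 (key (K.inv_mem hz) hw hz' hw')
  · exact Commute.inv_inv_iff.1 (key (K.inv_mem hz) (K.inv_mem hw) hz' hw')

theorem eventually_mem_iff {s : ℕ → A} (hs : Function.Injective s) (p q : A) :
    ∀ᶠ n in Filter.atTop, ((s n)⁻¹ * p ∈ P.carrier ↔ (s n)⁻¹ * q ∈ P.carrier) := by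
  have h := ((P.finite_separating p q).preimage hs.injOn).compl_mem_cofinite
  rw [Nat.cofinite_eq_atTop] at h
  filter_upwards [h] with n hn
  simpa using hn

/-- The half-spaces descend and `s 0` lies in none of them; only finitely many edges separate `p`
from `s 0`. -/
theorem eventually_notMem {s : ℕ → A} (hs : ∀ n, P.Pos ((s n)⁻¹ * s (n + 1))) (p : A) :
    ∀ᶠ n in Filter.atTop, (s n)⁻¹ * p ∉ P.carrier := by
  have step : ∀ n q, (s (n + 1))⁻¹ * q ∈ P.carrier → (s n)⁻¹ * q ∈ P.carrier := fun n q h =>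
    (hs n).mem_of_inv_mul_mem (by simpa [mul_assoc] using h)
  have anti : ∀ q {n k}, n ≤ k → (s k)⁻¹ * q ∈ P.carrier → (s n)⁻¹ * q ∈ P.carrier := by
    intro q n k hnk
    induction hnk with
    | refl => exact id
    | step _ ih => exact fun h => ih (step _ _ h)
  have hinj : Function.Injective s := by
    refine Nat.injective_of_forall_lt_ne fun n k hnk h => ?_
    have h1 := anti (s (n + 1)) (Nat.succ_le_of_lt hnk) (h ▸ (hs n).1)
    exact P.one_notMem (by simpa using h1)
  filter_upwards [eventually_mem_iff (P := P) hinj p (s 0)] with n hn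
  rw [hn]
  exact fun h => P.one_notMem (by simpa using anti (s 0) (Nat.zero_le n) h)

theorem eventually_mem {s : ℕ → A} (hs : ∀ n, P.Pos ((s (n + 1))⁻¹ * s n)) (p : A) :
    ∀ᶠ n in Filter.atTop, (s n)⁻¹ * p ∈ P.carrier := by
  have step : ∀ n q, (s n)⁻¹ * q ∈ P.carrier → (s (n + 1))⁻¹ * q ∈ P.carrier := fun n q h => by
    simpa [mul_assoc] using (hs n).mul_mem h
  have mono : ∀ q {n k}, n ≤ k → (s n)⁻¹ * q ∈ P.carrier → (s k)⁻¹ * q ∈ P.carrier := by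
    intro q n k hnk
    induction hnk with
    | refl => exact id
    | step _ ih => exact fun h => step _ _ (ih h)
  have hinj : Function.Injective s := by
    refine Nat.injective_of_forall_lt_ne fun n k hnk h => ?_
    have h1 := mono (s n) (Nat.succ_le_of_lt hnk) (hs n).1
    exact P.one_notMem (by simpa [h] using h1)
  obtain ⟨e, he⟩ := P.nonempty
  filter_upwards [eventually_mem_iff (P := P) hinj p (s 0 * e)] with n hn
  rw [hn]
  exact mono (s 0 * e) (Nat.zero_le n) (by simpa using he)

namespace IsIsometry

variable {F : Equiv.Perm A}

theorem mulLeft (a : A) : P.IsIsometry (Equiv.mulLeft a) := fun x y => by simp [mul_assoc]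

theorem inv (hF : P.IsIsometry F) : P.IsIsometry F⁻¹ := fun x y => by
  simpa using (hF (F⁻¹ x) (F⁻¹ y)).symm

theorem iterate (hF : P.IsIsometry F) (n : ℕ) (x y : A) :
    (F^[n] x)⁻¹ * F^[n] y ∈ P.carrier ↔ x⁻¹ * y ∈ P.carrier := by
  induction n with
  | zero => rfl
  | succ n ih => rw [Function.iterate_succ_apply', Function.iterate_succ_apply', hF, ih]

theorem pos_iff (hF : P.IsIsometry F) (x y : A) : P.Pos ((F x)⁻¹ * F y) ↔ P.Pos (x⁻¹ * y) := by
  have h := hF y x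
  have h' := hF x y
  simp only [Pos, mul_inv_rev, inv_inv]
  rw [h, h']

theorem pos_iterate_iff (hF : P.IsIsometry F) (n : ℕ) (x y : A) :
    P.Pos ((F^[n] x)⁻¹ * F^[n] y) ↔ P.Pos (x⁻¹ * y) := by
  simp only [Pos, mul_inv_rev, inv_inv]
  rw [hF.iterate n x y, hF.iterate n y x]

theorem eventually_iterate_notMem (hF : P.IsIsometry F) {x : A} (hx : P.Pos (x⁻¹ * F x)) (p : A) :
    ∀ᶠ n in Filter.atTop, (F^[n] x)⁻¹ * p ∉ P.carrier :=
  eventually_notMem (s := fun n => F^[n] x) (fun n => by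
    simpa only [Function.iterate_succ_apply] using (hF.pos_iterate_iff n x (F x)).2 hx) p

theorem eventually_iterate_inv_mem (hF : P.IsIsometry F) {x : A} (hx : P.Pos (x⁻¹ * F x)) (p : A) :
    ∀ᶠ n in Filter.atTop, ((⇑F⁻¹)^[n] x)⁻¹ * p ∈ P.carrier := by
  refine eventually_mem (s := fun n => (⇑F⁻¹)^[n] x) (fun n => ?_) p
  simp only [Function.iterate_succ_apply]
  rw [hF.inv.pos_iterate_iff n, ← hF.pos_iff]
  simpa using hx

/-- Two half-spaces which are both moved into themselves by an isometry are nested. -/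
theorem nested (hF : P.IsIsometry F) {x y : A} (hx : P.Pos (x⁻¹ * F x)) (hy : P.Pos (y⁻¹ * F y)) :
    x⁻¹ * y = 1 ∨ P.Pos (x⁻¹ * y) ∨ P.Pos (x⁻¹ * y)⁻¹ := by
  by_contra! h
  obtain ⟨hne, h1, h2⟩ := h
  have hxy : x ≠ y := fun h => hne (inv_mul_eq_one.2 h)
  have aux : ∀ u w : A, u ≠ w → ¬(u⁻¹ * w ∈ P.carrier ↔ u⁻¹ ∈ P.carrier) →
      (w⁻¹ ∈ P.carrier ↔ w⁻¹ * u ∈ P.carrier) := fun u w huw h => by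
    simpa using P.inv_mul_mem (z := u⁻¹ * w) (p := u⁻¹) (fun h => huw (inv_mul_eq_one.1 h)) h
  simp only [Pos, mul_inv_rev, inv_inv] at h1 h2
  -- Two non-nested configurations remain: the half-spaces cover the tree, or they are disjoint.
  -- Forward iteration of `F` pushes both off `1`, excluding the first; backward iteration makes
  -- both contain `1`, excluding the second.
  by_cases hz : x⁻¹ * y ∈ P.carrier
  · have hz' : y⁻¹ * x ∈ P.carrier := by tauto
    obtain ⟨n, hn, hn'⟩ :=
      ((hF.eventually_iterate_notMem hx 1).and (hF.eventually_iterate_notMem hy 1)).exists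
    rw [mul_one] at hn hn'
    have h3 := aux (F^[n] x) (F^[n] y) (fun h => hxy (F.injective.iterate n h))
      (by simpa [hn, hF.iterate] using hz)
    exact hn' (h3.2 ((hF.iterate n _ _).2 hz'))
  · have hz' : y⁻¹ * x ∉ P.carrier := by tauto
    obtain ⟨n, hn, hn'⟩ :=
      ((hF.eventually_iterate_inv_mem hx 1).and (hF.eventually_iterate_inv_mem hy 1)).exists
    rw [mul_one] at hn hn'
    have h3 := aux ((⇑F⁻¹)^[n] x) ((⇑F⁻¹)^[n] y) (fun h => hxy (F⁻¹.injective.iterate n h))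
      (by rw [hF.inv.iterate]; tauto)
    exact hz' ((hF.inv.iterate n _ _).1 (h3.1 hn'))

/-- For `k` in the centralizer of `F`, the half-space at `k * x` is also moved into itself, so
`nested` compares it with the one at `x`. Conjugated by `x`, the centralizer is thus linearly
ordered. -/
theorem commute_of_pos (hF : P.IsIsometry F) {x α β : A} (hx : P.Pos (x⁻¹ * F x))
    (hα : ∀ y, F (α * y) = α * F y) (hβ : ∀ y, F (β * y) = β * F y) : Commute α β := by
  let C : Subgroup A :=
    { carrier := {k | ∀ y, F (k * y) = k * F y}
      one_mem' := fun y => by simp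
      mul_mem' := fun {a b} ha hb y => by rw [mul_assoc, ha, hb, mul_assoc]
      inv_mem' := fun {a} ha y => by
        rw [eq_inv_mul_iff_mul_eq, ← ha, mul_inv_cancel_left] }
  have hK : ∀ k ∈ C.map (MulAut.conj x⁻¹).toMonoidHom, k = 1 ∨ P.Pos k ∨ P.Pos k⁻¹ := by
    rintro _ ⟨k, hk, rfl⟩
    have h := hF.nested hx (y := k * x) (by rw [hk]; simpa [mul_assoc] using hx)
    simpa [mul_assoc] using h
  have h := commute_of_subgroup hK (Subgroup.mem_map_of_mem _ (show α ∈ C from hα))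
    (Subgroup.mem_map_of_mem _ (show β ∈ C from hβ))
  exact (MulAut.conj x⁻¹).toEquiv.injective.eq_iff.1 (by
    simpa [Commute, SemiconjBy, map_mul] using h)

/-- An isometry which commutes with two non-commuting elements fixes every edge of the axis of one
of them. -/
theorem apply_eq_self (hF : P.IsIsometry F) {x α β : A} (hx : P.Pos (x⁻¹ * (α * x)))
    (hα : ∀ y, F (α * y) = α * F y) (hβ : ∀ y, F (β * y) = β * F y) (hαβ : ¬Commute α β) :
    F x = x := by
  rcases (mulLeft α).nested (x := x) (y := F x) hx
    (by simpa [← hα] using (hF.pos_iff x (α * x)).2 hx) with h | h | h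
  · exact (inv_mul_eq_one.1 h).symm
  · exact absurd (hF.commute_of_pos h hα hβ) hαβ
  · have inv_comm : ∀ {k : A}, (∀ y, F (k * y) = k * F y) → ∀ y, F⁻¹ (k * y) = k * F⁻¹ y :=
      fun hk y => by rw [Equiv.Perm.inv_eq_iff_eq, hk]; simp
    refine absurd (hF.inv.commute_of_pos (x := F x) ?_ (inv_comm hα) (inv_comm hβ)) hαβ
    simpa using h

/-- An isometry fixes an edge which is the first one on the way to an element. -/
theorem apply_eq_self_of_separating (hF : P.IsIsometry F) {x q : A}
    (ha : x⁻¹ * F x ∈ P.carrier ↔ (F x)⁻¹ * x ∈ P.carrier)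
    (hq : ¬(x⁻¹ * q ∈ P.carrier ↔ x⁻¹ * F x ∈ P.carrier))
    (hFq : x⁻¹ * F q ∈ P.carrier ↔ x⁻¹ * q ∈ P.carrier) : F x = x := by
  by_contra hne
  -- Edge `F x` separates `x` from `F q`, so `x` cannot separate `F x` from `F q`.
  have h := P.inv_mul_mem (z := (F x)⁻¹ * x) (p := (F x)⁻¹ * F q)
    (fun h => hne (inv_mul_eq_one.1 h)) (by rw [hF, ← ha]; tauto)
  simp only [mul_inv_rev, inv_inv, mul_assoc, mul_inv_cancel_left] at h
  tauto

end IsIsometry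

end HalfSpace

/-! ### First letters of reduced words as half-spaces -/

namespace FreeGroup

variable {ι : Type*}

section Word

variable [DecidableEq ι]

theorem IsReduced.toWord_mk {L : List (ι × Bool)} (hL : IsReduced L) : (mk L).toWord = L := by
  rw [FreeGroup.toWord_mk, hL.reduce_eq]

theorem IsReduced.invRev {L : List (ι × Bool)} (hL : IsReduced L) :
    IsReduced (FreeGroup.invRev L) := by
  rw [isReduced_iff_reduce_eq, reduce_invRev, hL.reduce_eq]

theorem toWord_mul_of_isReduced {x y : FreeGroup ι} (h : IsReduced (x.toWord ++ y.toWord)) :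
    (x * y).toWord = x.toWord ++ y.toWord := by
  rw [toWord_mul, h.reduce_eq]

/-- The elements of a free group whose reduced word only involves generators from `S`. -/
def supported (S : Set ι) : Subgroup (FreeGroup ι) where
  carrier := {x | ∀ l ∈ x.toWord, l.1 ∈ S}
  one_mem' := by simp
  mul_mem' := fun {x y} hx hy l hl => by
    rcases List.mem_append.1 ((toWord_mul_sublist x y).subset hl) with h | h
    · exact hx l h
    · exact hy l h
  inv_mem' := fun {x} hx l hl => by
    rw [toWord_inv, FreeGroup.invRev, List.mem_reverse, List.mem_map] at hl
    obtain ⟨l', h, rfl⟩ := hl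
    exact hx l' h

variable {S T : Set ι}

theorem mem_supported {x : FreeGroup ι} : x ∈ supported S ↔ ∀ l ∈ x.toWord, l.1 ∈ S := Iff.rfl

theorem mk_mem_supported {L : List (ι × Bool)} (hL : ∀ l ∈ L, l.1 ∈ S) : mk L ∈ supported S :=
  fun l hl => hL l (reduce.red.sublist.subset hl)

theorem of_mem_supported {i : ι} (hi : i ∈ S) : of i ∈ supported S := by
  simpa [mem_supported] using hi

theorem supported_mono (h : S ⊆ T) : supported S ≤ supported T := fun _ hx l hl => h (hx l hl)

theorem mem_supported_of_prefix {x y : FreeGroup ι} (h : x.toWord <+: y.toWord)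
    (hy : y ∈ supported S) : x ∈ supported S := fun l hl => hy l (h.subset hl)

theorem supported_le {K : Subgroup (FreeGroup ι)} (h : ∀ i ∈ S, of i ∈ K) : supported S ≤ K := by
  intro x hx
  rw [← mk_toWord (x := x)]
  rw [mem_supported] at hx
  generalize x.toWord = L at hx
  induction L with
  | nil => exact K.one_mem
  | cons l L ih =>
    rw [← List.singleton_append, ← mul_mk]
    refine K.mul_mem ?_ (ih fun l' hl' => hx l' (List.mem_cons_of_mem _ hl'))
    obtain ⟨i, b⟩ := l
    have hi : of i ∈ K := h i (hx (i, b) List.mem_cons_self)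
    cases b
    · simpa [of, inv_mk, FreeGroup.invRev] using K.inv_mem hi
    · exact hi

/-- The elements whose reduced word starts with the generator `e`. -/
def startingWith (e : ι) : Set (FreeGroup ι) := {x | x.toWord.head? = some (e, true)}

variable {e : ι}

theorem mem_startingWith {x : FreeGroup ι} :
    x ∈ startingWith e ↔ x.toWord.head? = some (e, true) := Iff.rfl

theorem one_notMem_startingWith : (1 : FreeGroup ι) ∉ startingWith e := by
  simp [mem_startingWith]

theorem of_mem_startingWith : of e ∈ startingWith e := by simp [mem_startingWith]

theorem notMem_startingWith_of_mem_supported (he : e ∉ S) {c : FreeGroup ι}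
    (hc : c ∈ supported S) : c ∉ startingWith e := fun h =>
  he (hc (e, true) (List.mem_of_mem_head? h))

/-- A positive generator on the right can only cancel a letter `(i, false)`, never a leading `(e,
true)`. -/
theorem mul_of_mem_startingWith {y : FreeGroup ι} {i : ι} :
    y * of i ∈ startingWith e ↔ y ∈ startingWith e ∨ (y = 1 ∧ i = e) := by
  rcases List.eq_nil_or_concat y.toWord with h | ⟨L, l, h⟩
  · obtain rfl := toWord_eq_nil_iff.1 h
    simp [mem_startingWith]
  have hr : IsReduced (L ++ [l]) := by simpa [h] using isReduced_toWord (x := y)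
  have hy : y = mk (L ++ [l]) := by simpa [h] using (mk_toWord (x := y)).symm
  have hy1 : y ≠ 1 := by
    rw [ne_eq, ← toWord_eq_nil_iff, h]
    simp
  simp only [hy1, false_and, or_false]
  by_cases hl : l = (i, false)
  · have h1 : y * of i = mk L := by
      rw [hy, ← mul_mk, hl, mul_assoc, of, mul_mk]
      have : mk [(i, false), (i, true)] = 1 := by
        simpa [of, inv_mk, FreeGroup.invRev] using inv_mul_cancel (of i)
      simp [this]
    have hL : IsReduced L := hr.infix ⟨[], [l], by simp⟩
    rw [mem_startingWith, mem_startingWith, h1, hL.toWord_mk, h, hl]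
    cases L <;> simp
  · have h1 : IsReduced (y.toWord ++ (of i).toWord) := by
      rw [toWord_of]
      refine List.IsChain.append isReduced_toWord IsReduced.singleton ?_
      rw [h]
      rintro a ha b hb hab
      simp only [List.concat_eq_append, List.getLast?_append, List.getLast?_singleton,
        Option.some_or, Option.mem_def, Option.some.injEq, List.head?_cons] at ha hb
      subst ha hb
      obtain ⟨j, c⟩ := l
      cases c
      · exact absurd (by simpa using hab) hl
      · rfl
    rw [mem_startingWith, mem_startingWith, toWord_mul_of_isReduced h1, h]
    cases L <;> simp

theorem mul_mem_startingWith_iff (he : e ∉ S) {c : FreeGroup ι} (hc : c ∈ supported S)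
    (y : FreeGroup ι) : y * c ∈ startingWith e ↔ y ∈ startingWith e := by
  let K : Subgroup (FreeGroup ι) :=
    { carrier := {c | ∀ y, y * c ∈ startingWith e ↔ y ∈ startingWith e}
      one_mem' := by simp
      mul_mem' := fun {a b} ha hb y => by rw [← mul_assoc, hb, ha]
      inv_mem' := fun {a} ha y => by rw [← ha, inv_mul_cancel_right] }
  refine supported_le (K := K) (fun i hi y => ?_) hc y
  rw [mul_of_mem_startingWith]
  have : i ≠ e := fun h => he (h ▸ hi)
  simp [this]

/-- Cancellation at the junction would require `z` and `p` to have the same first letter. -/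
theorem toWord_inv_mul {z p : FreeGroup ι}
    (h : ¬(z ∈ startingWith e ↔ p ∈ startingWith e)) :
    (z⁻¹ * p).toWord = z⁻¹.toWord ++ p.toWord := by
  refine toWord_mul_of_isReduced (List.IsChain.append isReduced_toWord isReduced_toWord ?_)
  intro a ha b hb hab
  rw [toWord_inv, FreeGroup.invRev] at ha
  simp only [List.getLast?_reverse, List.head?_map, Option.mem_def, Option.map_eq_some_iff] at ha hb
  obtain ⟨l, hl, rfl⟩ := ha
  by_contra hne
  have : l = b := Prod.ext hab (by simpa using hne)
  subst this
  rw [mem_startingWith, mem_startingWith, hl, hb] at h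
  exact h Iff.rfl

theorem inv_mul_mem_startingWith {z p : FreeGroup ι} (hz : z ≠ 1)
    (h : ¬(z ∈ startingWith e ↔ p ∈ startingWith e)) :
    z⁻¹ * p ∈ startingWith e ↔ z⁻¹ ∈ startingWith e := by
  have hne : z⁻¹.toWord ≠ [] := by simpa only [ne_eq, toWord_eq_nil_iff, inv_eq_one] using hz
  rw [mem_startingWith, mem_startingWith, toWord_inv_mul h, List.head?_append_of_ne_nil _ hne]

theorem norm_mul_of_mem_startingWith {z w : FreeGroup ι}
    (hz' : z⁻¹ ∉ startingWith e) (hw : w ∈ startingWith e) : norm (z * w) = norm z + norm w := by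
  have h := toWord_inv_mul (e := e) (z := z⁻¹) (p := w) (by simp [hz', hw])
  rw [inv_inv] at h
  simp [norm, h]

/-- Go from `p` to `q` one generator at a time: only the edge `x = p` can separate `p` from `p * of
i`. -/
theorem finite_separating (p q : FreeGroup ι) :
    {x : FreeGroup ι | ¬(x⁻¹ * p ∈ startingWith e ↔ x⁻¹ * q ∈ startingWith e)}.Finite := by
  obtain ⟨w, rfl⟩ : ∃ w, q = p * w := ⟨p⁻¹ * q, by simp⟩
  have hof : ∀ (i : ι) (p : FreeGroup ι),
      {x : FreeGroup ι | ¬(x⁻¹ * p ∈ startingWith e ↔ x⁻¹ * (p * of i) ∈ startingWith e)}.Finite :=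
    fun i p => (Set.finite_singleton p).subset fun x hx => by
      rw [Set.mem_ofPred_eq, ← mul_assoc, mul_of_mem_startingWith] at hx
      have h : x⁻¹ * p = 1 := by tauto
      exact inv_mul_eq_one.1 h
  induction w using FreeGroup.induction_on generalizing p with
  | C1 => simp
  | of i => exact hof i p
  | inv_of i _ =>
    refine (hof i (p * (of i)⁻¹)).subset fun x hx => ?_
    simp only [Set.mem_ofPred_eq, inv_mul_cancel_right] at hx ⊢
    tauto
  | mul v w hv hw =>
    refine ((hv p).union (hw (p * v))).subset fun x hx => ?_
    simp only [Set.mem_ofPred_eq, Set.mem_union, mul_assoc] at hx ⊢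
    tauto

/-- The half-space of the elements of a subgroup whose reduced word starts with `e`. -/
def halfSpace (A : Subgroup (FreeGroup ι)) (he : of e ∈ A) : HalfSpace A where
  carrier := {x | (x : FreeGroup ι) ∈ startingWith e}
  one_notMem := one_notMem_startingWith
  nonempty := ⟨⟨of e, he⟩, of_mem_startingWith⟩
  inv_mul_mem := fun {z p} hz h =>
    inv_mul_mem_startingWith (z := (z : FreeGroup ι)) (p := p) (by simpa using hz) h
  finite_separating := fun p q =>
    (finite_separating (p : FreeGroup ι) q).preimage Subtype.val_injective.injOn
  length := fun x => norm (x : FreeGroup ι)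
  length_mul := fun hz hw => norm_mul_of_mem_startingWith hz hw
  eq_one_of_length := fun hz => Subtype.ext (norm_eq_zero.1 hz)

theorem mem_halfSpace {A : Subgroup (FreeGroup ι)} {he : of e ∈ A} {x : A} :
    x ∈ (halfSpace A he).carrier ↔ (x : FreeGroup ι) ∈ startingWith e := Iff.rfl

theorem IsReduced.inv_mk_notMem_startingWith {L : List (ι × Bool)}
    (hL : IsReduced (L ++ [(e, true)])) : (mk L)⁻¹ ∉ startingWith e := by
  have h1 : IsReduced L := hL.infix ⟨[], [(e, true)], by simp⟩
  have h2 := hL.invRev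
  rw [invRev_append] at h2
  rw [mem_startingWith, inv_mk, h1.invRev.toWord_mk]
  intro h
  have h3 : FreeGroup.invRev [(e, true)] = [(e, false)] := by simp [FreeGroup.invRev]
  rw [h3, List.singleton_append, IsReduced, List.isChain_cons] at h2
  simpa using h2.1 _ h rfl

/-- Write `a = a₁ e a₂` and take `x = W a₁`: conjugating by `x` rotates the cyclically reduced word
to `e a₂ a₁`, which starts with `e` and does not end with `e⁻¹`. -/
theorem exists_axis_of_mem {W a : List (ι × Bool)} (hr : IsReduced (W ++ a ++ invRev W))
    (haa : IsReduced (a ++ a)) (hea : (e, true) ∈ a) :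
    ∃ x : FreeGroup ι, x.toWord <+: W ++ a ++ invRev W ∧
      x⁻¹ * (mk (W ++ a ++ invRev W) * x) ∈ startingWith e ∧
      (x⁻¹ * (mk (W ++ a ++ invRev W) * x))⁻¹ ∉ startingWith e := by
  obtain ⟨a₁, a₂, rfl⟩ := List.append_of_mem hea
  have hx : IsReduced (W ++ a₁) := hr.infix ⟨[], (e, true) :: a₂ ++ invRev W, by simp⟩
  have hz : (mk (W ++ a₁))⁻¹ * (mk (W ++ (a₁ ++ (e, true) :: a₂) ++ invRev W) * mk (W ++ a₁)) =
      mk ((e, true) :: a₂ ++ a₁) := by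
    rw [show (e, true) :: a₂ = [(e, true)] ++ a₂ from rfl]
    simp only [← mul_mk, ← inv_mk]
    group
  have hE : IsReduced ((e, true) :: a₂ ++ a₁ ++ [(e, true)]) := haa.infix ⟨a₁, a₂, by simp⟩
  refine ⟨mk (W ++ a₁), ?_, ?_, ?_⟩
  · rw [hx.toWord_mk]
    exact ⟨(e, true) :: a₂ ++ invRev W, by simp⟩
  · rw [hz, mem_startingWith, (hE.infix ⟨[], [(e, true)], by simp⟩ :
      IsReduced ((e, true) :: a₂ ++ a₁)).toWord_mk]
    simp
  · rw [hz]
    exact hE.inv_mk_notMem_startingWith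

/-- An element either is conjugate to one which does not involve the generator `e`, or it or its
inverse translates a half-space into itself. -/
theorem exists_conj_mem_or_axis {α : FreeGroup ι} (hα : α ∈ supported (insert e S)) :
    (∃ p : FreeGroup ι, p.toWord <+: α.toWord ∧ p⁻¹ * α * p ∈ supported S) ∨
    ∃ β, (β = α ∨ β = α⁻¹) ∧ ∃ x : FreeGroup ι, x.toWord <+: β.toWord ∧
      x⁻¹ * (β * x) ∈ startingWith e ∧ (x⁻¹ * (β * x))⁻¹ ∉ startingWith e := by
  set W := reduceCyclically.conjugator α.toWord with hW
  set a := reduceCyclically α.toWord with ha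
  have hα' : W ++ a ++ invRev W = α.toWord :=
    reduceCyclically.conj_conjugator_reduceCyclically α.toWord
  have hαmk : mk (W ++ a ++ invRev W) = α := by rw [hα', mk_toWord]
  have hr : IsReduced (W ++ a ++ invRev W) := hα' ▸ isReduced_toWord
  have haa : IsReduced (a ++ a) := by
    simpa using ((reduceCyclically.isCyclicallyReduced
      (isReduced_toWord (x := α))).flatten_replicate 2).isReduced
  by_cases hS : ∀ l ∈ a, l.1 ∈ S
  · refine Or.inl ⟨mk W, ?_, ?_⟩
    · rw [(hr.infix ⟨[], a ++ invRev W, by simp⟩ : IsReduced W).toWord_mk, ← hα']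
      exact ⟨a ++ invRev W, by simp⟩
    · have : (mk W)⁻¹ * α * mk W = mk a := by
        rw [← hαmk, ← mul_mk, ← mul_mk, ← inv_mk]
        group
      rw [this]
      exact mk_mem_supported hS
  · right
    push Not at hS
    obtain ⟨⟨i, b⟩, hl, hlS⟩ := hS
    obtain rfl : i = e := (hα (i, b) (by rw [← hα']; simp [hl])).resolve_right hlS
    cases b
    · have hinv : invRev (W ++ a ++ invRev W) = W ++ invRev a ++ invRev W := by
        simp [invRev_append]
      have hmk : α⁻¹ = mk (W ++ invRev a ++ invRev W) := by rw [← hαmk, inv_mk, hinv]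
      have hr' := hr.invRev
      rw [hinv] at hr'
      obtain ⟨x, hx, h1, h2⟩ := exists_axis_of_mem (e := i) hr'
        (by simpa [invRev_append] using haa.invRev)
        (by simpa [FreeGroup.invRev] using hl)
      rw [← hmk] at h1 h2
      exact ⟨α⁻¹, Or.inr rfl, x, by rwa [hmk, hr'.toWord_mk], h1, h2⟩
    · obtain ⟨x, hx, h1, h2⟩ := exists_axis_of_mem (e := i) hr haa hl
      rw [hαmk] at h1 h2
      exact ⟨α, Or.inl rfl, x, hα' ▸ hx, h1, h2⟩

/-- The first occurrence of the generator `e` in a word. -/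
theorem exists_first_edge {q : FreeGroup ι} (hq : q ∈ supported (insert e S))
    (hqS : q ∉ supported S) (he : e ∉ S) : ∃ x : FreeGroup ι, x.toWord <+: q.toWord ∧
      ((x ∈ supported S ∧ x⁻¹ * q ∈ startingWith e) ∨
        (x * of e ∈ supported S ∧ x⁻¹ * q ∉ startingWith e)) := by
  have hsplit : ∀ L : List (ι × Bool), (∀ l ∈ L, l.1 ∈ insert e S) → (¬∀ l ∈ L, l.1 ∈ S) →
      ∃ c b t, L = c ++ (e, b) :: t ∧ ∀ l ∈ c, l.1 ∈ S := by
    intro L hL hLS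
    induction L with
    | nil => simp at hLS
    | cons l L ih =>
      by_cases hl : l.1 ∈ S
      · obtain ⟨c, b, t, rfl, hc⟩ := ih (fun l' h => hL l' (List.mem_cons_of_mem _ h)) (by
          simpa [hl] using hLS)
        exact ⟨l :: c, b, t, rfl, by simpa [hl] using hc⟩
      · obtain ⟨i, b⟩ := l
        obtain rfl : i = e := (hL (i, b) List.mem_cons_self).resolve_right hl
        exact ⟨[], b, L, rfl, by simp⟩
  obtain ⟨c, b, t, h, hc⟩ := hsplit q.toWord hq hqS
  have hr : IsReduced (c ++ (e, b) :: t) := h ▸ isReduced_toWord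
  have hq' : q = mk (c ++ (e, b) :: t) := by rw [← h, mk_toWord]
  cases b
  -- Edge `x` points from `x` to `x * of e`, so crossing it backwards from `c` means `x = c e⁻¹`,
  -- with `q` on the initial side.
  · refine ⟨mk (c ++ [(e, false)]), ?_, Or.inr ⟨?_, ?_⟩⟩
    · rw [(hr.infix ⟨[], t, by simp⟩ : IsReduced (c ++ [(e, false)])).toWord_mk, h]
      exact ⟨t, by simp⟩
    · have : mk (c ++ [(e, false)]) * of e = mk c := by
        have h1 : mk [(e, false)] = (of e)⁻¹ := by simp [of, inv_mk, FreeGroup.invRev]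
        rw [← mul_mk, h1, inv_mul_cancel_right]
      rw [this]
      exact mk_mem_supported hc
    · have : (mk (c ++ [(e, false)]))⁻¹ * q = mk t := by
        rw [hq', show c ++ (e, false) :: t = (c ++ [(e, false)]) ++ t by simp,
          ← mul_mk (L₂ := t), inv_mul_cancel_left]
      have ht : IsReduced ((e, false) :: t) := hr.infix ⟨c, [], by simp⟩
      rw [this, mem_startingWith, (ht.infix ⟨[(e, false)], [], by simp⟩ : IsReduced t).toWord_mk]
      intro h'
      rw [IsReduced, List.isChain_cons] at ht
      simpa using ht.1 _ h' rfl
  · refine ⟨mk c, ?_, Or.inl ⟨mk_mem_supported hc, ?_⟩⟩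
    · rw [(hr.infix ⟨[], (e, true) :: t, by simp⟩ : IsReduced c).toWord_mk, h]
      exact ⟨_, rfl⟩
    · rw [hq', ← mul_mk, inv_mul_cancel_left, mem_startingWith,
        (hr.infix ⟨c, [], by simp⟩ : IsReduced ((e, true) :: t)).toWord_mk]
      simp

end Word

end FreeGroup

/-! ### Upper triangular endomorphisms and their affine maps -/

namespace FreeGroup

variable {m : ℕ}

/-- The subgroup generated by the first `r` generators. -/
def lower (m r : ℕ) : Subgroup (FreeGroup (Fin m)) := supported {i | (i : ℕ) < r}

theorem lower_mono {r s : ℕ} (h : r ≤ s) : lower m r ≤ lower m s :=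
  supported_mono fun _ hi => lt_of_lt_of_le hi h

theorem mem_lower_self (x : FreeGroup (Fin m)) : x ∈ lower m m := fun l _ => l.1.2

theorem lower_succ {r : ℕ} (hr : r < m) :
    lower m (r + 1) = supported (insert (⟨r, hr⟩ : Fin m) {i : Fin m | (i : ℕ) < r}) := by
  refine congrArg supported (Set.ext fun i => ?_)
  simp only [Set.mem_insert_iff, Set.mem_ofPred_eq, Fin.ext_iff]
  omega

theorem of_mem_lower {r : ℕ} {i : Fin m} (hi : (i : ℕ) < r) : of i ∈ lower m r :=
  of_mem_supported hi

theorem lower_le {r : ℕ} {K : Subgroup (FreeGroup (Fin m))}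
    (h : ∀ i : Fin m, (i : ℕ) < r → of i ∈ K) : lower m r ≤ K := supported_le h

/-- An endomorphism of a free group is upper triangular if it multiplies each generator by a
product of the preceding ones. -/
def IsTriangular (φ : FreeGroup (Fin m) →* FreeGroup (Fin m)) : Prop :=
  ∀ i : Fin m, ∃ u ∈ lower m i, φ (of i) = of i * u

namespace IsTriangular

variable {φ : FreeGroup (Fin m) →* FreeGroup (Fin m)}

theorem id : IsTriangular (MonoidHom.id (FreeGroup (Fin m))) := fun i =>
  ⟨1, one_mem _, by simp⟩

theorem map_mem (hφ : IsTriangular φ) {r : ℕ} {x : FreeGroup (Fin m)} (hx : x ∈ lower m r) :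
    φ x ∈ lower m r := by
  refine lower_le (K := (lower m r).comap φ) (fun i hi => ?_) hx
  obtain ⟨u, hu, h⟩ := hφ i
  rw [Subgroup.mem_comap, h]
  exact mul_mem (of_mem_lower hi) (lower_mono hi.le hu)

theorem lower_le_map (hφ : IsTriangular φ) (r : ℕ) : lower m r ≤ (lower m r).map φ := by
  induction r using Nat.strong_induction_on with
  | _ r ih =>
    refine lower_le fun i hi => ?_
    obtain ⟨u, hu, h⟩ := hφ i
    rw [eq_mul_inv_of_mul_eq h.symm]
    exact mul_mem (Subgroup.mem_map_of_mem _ (of_mem_lower hi))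
      (inv_mem (Subgroup.map_mono (lower_mono hi.le) (ih i hi hu)))

theorem exists_map_eq (hφ : IsTriangular φ) {r : ℕ} {y : FreeGroup (Fin m)}
    (hy : y ∈ lower m r) : ∃ x ∈ lower m r, φ x = y := hφ.lower_le_map r hy

/-- There is a triangular right inverse `ψ`; being triangular, `ψ` is surjective, so `φ` is
injective. -/
theorem injective (hφ : IsTriangular φ) : Function.Injective φ := by
  choose u hu h using hφ
  have hφ : IsTriangular φ := fun i => ⟨u i, hu i, h i⟩
  choose y hy hyu using fun i => hφ.exists_map_eq (hu i)
  let ψ : FreeGroup (Fin m) →* FreeGroup (Fin m) := lift fun i => of i * (y i)⁻¹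
  have hψ : IsTriangular ψ := fun i => ⟨(y i)⁻¹, inv_mem (hy i), by simp [ψ]⟩
  have hφψ : φ.comp ψ = MonoidHom.id _ := by
    ext i
    simp [ψ, h, hyu]
  intro a b hab
  obtain ⟨a, -, rfl⟩ := hψ.exists_map_eq (mem_lower_self a)
  obtain ⟨b, -, rfl⟩ := hψ.exists_map_eq (mem_lower_self b)
  have hid : ∀ x, φ (ψ x) = x := fun x => DFunLike.congr_fun hφψ x
  rw [hid, hid] at hab
  rw [hab]

theorem map_mem_startingWith_iff (hφ : IsTriangular φ) {r : ℕ} (hr : r < m)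
    {y : FreeGroup (Fin m)} (hy : y ∈ lower m (r + 1)) :
    φ y ∈ startingWith ⟨r, hr⟩ ↔ y ∈ startingWith ⟨r, hr⟩ := by
  have hone : ∀ z, φ z = 1 ↔ z = 1 := fun z => map_eq_one_iff φ hφ.injective
  -- Comparing `z * c` with `z` makes the admissible `c` a subgroup, so generators suffice; the
  -- extra factor `u` does not affect a leading `e`.
  let K : Subgroup (FreeGroup (Fin m)) :=
    { carrier := {c | ∀ z, (φ (z * c) ∈ startingWith ⟨r, hr⟩ ↔ z * c ∈ startingWith ⟨r, hr⟩) ↔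
        (φ z ∈ startingWith ⟨r, hr⟩ ↔ z ∈ startingWith ⟨r, hr⟩)}
      one_mem' := by simp
      mul_mem' := fun {a b} ha hb z => by rw [← mul_assoc, hb, ha]
      inv_mem' := fun {a} ha z => by rw [← ha, inv_mul_cancel_right] }
  have hK : lower m (r + 1) ≤ K := by
    refine lower_le fun i hi z => ?_
    obtain ⟨u, hu, h⟩ := hφ i
    have hu' : u ∈ lower m r := lower_mono (Nat.lt_succ_iff.1 hi) hu
    have h1 : (⟨r, hr⟩ : Fin m) ∉ {i : Fin m | (i : ℕ) < r} := by simp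
    rw [_root_.map_mul, h, ← mul_assoc, mul_mem_startingWith_iff h1 hu',
      mul_of_mem_startingWith, mul_of_mem_startingWith, hone]
    by_cases hz : z = 1 ∧ i = ⟨r, hr⟩
    · obtain ⟨rfl, rfl⟩ := hz
      simp
    · simp only [hz, or_false]
  have h := hK hy 1
  rw [one_mul, _root_.map_one] at h
  exact h.2 (by simp)

variable {r : ℕ} {b : FreeGroup (Fin m)}

/-- The permutation `y ↦ b * φ y` of the subgroup generated by the first generators. -/
noncomputable def affine (hφ : IsTriangular φ) (hb : b ∈ lower m r) : Equiv.Perm (lower m r) :=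
  Equiv.ofBijective (fun y => ⟨b * φ y, mul_mem hb (hφ.map_mem y.2)⟩) <| by
    refine ⟨fun x y h => Subtype.ext (hφ.injective ?_), fun y => ?_⟩
    · simpa using h
    · obtain ⟨x, hx, h⟩ := hφ.exists_map_eq (mul_mem (inv_mem hb) y.2)
      exact ⟨⟨x, hx⟩, Subtype.ext (by simp [h])⟩

@[simp] theorem coe_affine (hφ : IsTriangular φ) (hb : b ∈ lower m r) (y : lower m r) :
    (hφ.affine hb y : FreeGroup (Fin m)) = b * φ y := rfl

theorem isIsometry_affine (hφ : IsTriangular φ) (hr : r < m) (hb : b ∈ lower m (r + 1)) :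
    (halfSpace (lower m (r + 1)) (of_mem_lower (i := ⟨r, hr⟩) r.lt_succ_self)).IsIsometry
      (hφ.affine hb) := fun x y => by
  simp only [mem_halfSpace, Subgroup.coe_mul, Subgroup.coe_inv, coe_affine]
  rw [← hφ.map_mem_startingWith_iff hr (mul_mem (inv_mem x.2) y.2)]
  simp [mul_assoc]

theorem affine_apply_mul (hφ : IsTriangular φ) (hb : b ∈ lower m r) {α : FreeGroup (Fin m)}
    (hα : α ∈ lower m r) (h : b * φ α = α * b) (y : lower m r) :
    hφ.affine hb (⟨α, hα⟩ * y) = ⟨α, hα⟩ * hφ.affine hb y :=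
  Subtype.ext (by simp [← mul_assoc, h])

/-- If `y ↦ b * φ y` maps two elements to the cosets of the lower subgroup which they represent,
then it fixes the first edge between these cosets. -/
theorem apply_eq_of_first_edge (hφ : IsTriangular φ) (hr : r < m) (hb : b ∈ lower m r)
    {q γ x : FreeGroup (Fin m)} (hq : q ∈ lower m (r + 1)) (hγ : γ ∈ lower m r)
    (hqγ : b * φ q = q * γ) (hx : x ∈ lower m (r + 1))
    (hxq : (x ∈ lower m r ∧ x⁻¹ * q ∈ startingWith ⟨r, hr⟩) ∨
      (x * of ⟨r, hr⟩ ∈ lower m r ∧ x⁻¹ * q ∉ startingWith ⟨r, hr⟩)) : b * φ x = x := by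
  have he : (⟨r, hr⟩ : Fin m) ∉ {i : Fin m | (i : ℕ) < r} := by simp
  have hlow : ∀ {c}, c ∈ lower m r → c ∉ startingWith ⟨r, hr⟩ := fun hc =>
    notMem_startingWith_of_mem_supported he hc
  have hb' := lower_mono r.le_succ hb
  by_contra hne
  have ha : (x⁻¹ * (b * φ x) ∈ startingWith ⟨r, hr⟩ ↔ (b * φ x)⁻¹ * x ∈ startingWith ⟨r, hr⟩) ∧
      ¬(x⁻¹ * q ∈ startingWith ⟨r, hr⟩ ↔ x⁻¹ * (b * φ x) ∈ startingWith ⟨r, hr⟩) := by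
    rcases hxq with ⟨hxr, hxq⟩ | ⟨hxr, hxq⟩
    -- Both edges start at the base vertex, so neither is beyond the other.
    · have h1 := hlow (mul_mem (inv_mem hxr) (mul_mem hb (hφ.map_mem hxr)))
      have h2 := hlow (mul_mem (inv_mem (mul_mem hb (hφ.map_mem hxr))) hxr)
      tauto
    -- Both edges end at the base vertex, so if distinct each is beyond the other.
    · obtain ⟨u, hu, h⟩ := hφ ⟨r, hr⟩
      have hE : ∀ d ∈ lower m r, ∀ y, y ≠ 1 → y * of ⟨r, hr⟩ = of ⟨r, hr⟩ * d →
          y ∈ startingWith ⟨r, hr⟩ := fun d hd y hy hyd => by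
        have h1 : y * of ⟨r, hr⟩ ∈ startingWith ⟨r, hr⟩ := by
          rw [hyd]
          exact (mul_mem_startingWith_iff he hd _).2 of_mem_startingWith
        simpa [mul_of_mem_startingWith, hy] using h1
      have hx' : φ x * of ⟨r, hr⟩ = φ (x * of ⟨r, hr⟩) * u⁻¹ := by
        rw [_root_.map_mul, h]
        group
      have hd : (x * of ⟨r, hr⟩)⁻¹ * (b * (φ (x * of ⟨r, hr⟩) * u⁻¹)) ∈ lower m r :=
        mul_mem (inv_mem hxr) (mul_mem hb (mul_mem (hφ.map_mem hxr) (inv_mem hu)))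
      have h1 := hE _ hd (x⁻¹ * (b * φ x)) (fun h => hne (inv_mul_eq_one.1 h).symm) (by
        rw [mul_assoc, mul_assoc, hx']
        group)
      have h2 := hE _ (inv_mem hd) ((b * φ x)⁻¹ * x) (fun h => hne (inv_mul_eq_one.1 h)) (by
        rw [← hx']
        group)
      tauto
  refine hne ?_
  have := (hφ.isIsometry_affine hr hb').apply_eq_self_of_separating (x := ⟨x, hx⟩) (q := ⟨q, hq⟩)
    ha.1 ha.2 (by
      simp only [mem_halfSpace, Subgroup.coe_mul, Subgroup.coe_inv, coe_affine]
      rw [hqγ, ← mul_assoc]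
      exact mul_mem_startingWith_iff he hγ _)
  exact congrArg Subtype.val this

/-- The edge depends on `q` alone, so one `x` serves both affine maps. -/
theorem exists_first_edge_fixed (hr : r < m) {q : FreeGroup (Fin m)} (hq : q ∈ lower m (r + 1))
    (hq' : q ∉ lower m r) : ∃ x ∈ lower m (r + 1), x.toWord <+: q.toWord ∧
      ∀ {φ : FreeGroup (Fin m) →* FreeGroup (Fin m)} {b γ : FreeGroup (Fin m)}, IsTriangular φ →
        b ∈ lower m r → γ ∈ lower m r → b * φ q = q * γ → b * φ x = x := by
  obtain ⟨x, hx, h⟩ := exists_first_edge (e := ⟨r, hr⟩) (lower_succ hr ▸ hq) hq' (by simp)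
  exact ⟨x, mem_supported_of_prefix hx hq, hx, fun hφ hb hγ hqγ =>
    hφ.apply_eq_of_first_edge hr hb hq hγ hqγ (mem_supported_of_prefix hx hq) h⟩

/-- Translation by `α`, the affine map of the identity endomorphism, fixes the vertices of `1` and
`b`. Were they distinct it would fix an edge, but translations act freely on edges. -/
theorem mem_lower_of_conj_of_mem_succ (hφ : IsTriangular φ) (hr : r < m) {α : FreeGroup (Fin m)}
    (hα : α ∈ lower m r) (hα1 : α ≠ 1) (hb : b ∈ lower m (r + 1)) (h : b * φ α = α * b) :
    b ∈ lower m r := by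
  by_contra hbr
  obtain ⟨x, -, -, hx⟩ := exists_first_edge_fixed hr hb hbr
  exact hα1 (by simpa using hx IsTriangular.id hα (hφ.map_mem hα) h.symm)

theorem mem_lower_of_conj (hφ : IsTriangular φ) (hr : r ≤ m) {α : FreeGroup (Fin m)}
    (hα : α ∈ lower m r) (hα1 : α ≠ 1) (h : b * φ α = α * b) : b ∈ lower m r := by
  refine Nat.decreasingInduction' (P := fun k => b ∈ lower m k) (fun k hk hrk hb => ?_) hr
    (mem_lower_self b)
  exact hφ.mem_lower_of_conj_of_mem_succ hk (lower_mono hrk hα) hα1 hb h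

end IsTriangular

end FreeGroup

/-! ### Edge paths in the free group, and the induction on height -/

namespace FilteredGraph

open FreeGroup hiding map_mul map_one map_inv

variable {V : Type*} {m : ℕ} {G : FilteredGraph V m}

theorem IsPath.of_step {u w : V} {p q : List (Fin m × Bool)} (hp : G.IsPath u p w)
    (h : Red.Step p q) : G.IsPath u q w := by
  obtain @⟨L₁, L₂, i, b⟩ := h
  induction L₁ generalizing u with
  | nil =>
    obtain ⟨rfl, -, h⟩ := hp
    cases b <;> exact h
  | cons e L ih => exact ⟨hp.1, ih hp.2⟩

theorem IsPath.of_red {u w : V} {p q : List (Fin m × Bool)} (hp : G.IsPath u p w)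
    (h : Red p q) : G.IsPath u q w := by
  induction h with
  | refl => exact hp
  | tail _ h ih => exact ih.of_step h

theorem IsPath.exists_of_append {u w : V} {p q : List (Fin m × Bool)}
    (h : G.IsPath u (p ++ q) w) : ∃ v, G.IsPath u p v ∧ G.IsPath v q w := by
  induction p generalizing u with
  | nil => exact ⟨u, rfl, h⟩
  | cons e p ih =>
    obtain ⟨v, h1, h2⟩ := ih h.2
    exact ⟨v, ⟨h.1, h1⟩, h2⟩

/-- The element of the free group on the edges is represented by an edge path from `u` to `w`. -/
def Joins (G : FilteredGraph V m) (u : V) (x : FreeGroup (Fin m)) (w : V) : Prop :=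
  G.IsPath u x.toWord w

theorem joins_mk {u w : V} {p : List (Fin m × Bool)} (hp : G.IsPath u p w) :
    G.Joins u (FreeGroup.mk p) w := hp.of_red reduce.red

namespace Joins

variable {u v w : V} {x y : FreeGroup (Fin m)}

theorem mul (hx : G.Joins u x v) (hy : G.Joins v y w) : G.Joins u (x * y) w := by
  have h := joins_mk (isPath_append hx hy)
  rwa [← mul_mk, mk_toWord, mk_toWord] at h

theorem inv (hx : G.Joins u x w) : G.Joins w x⁻¹ u := by
  have h := joins_mk (isPath_invRev hx)
  rwa [← inv_mk, mk_toWord] at h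

/-- This is why prefixes are tracked: an arbitrary element of the free group need not be an edge
path. -/
theorem exists_of_prefix (hy : G.Joins u y w) (h : x.toWord <+: y.toWord) :
    ∃ v, G.Joins u x v := by
  obtain ⟨t, ht⟩ := h
  rw [Joins, ← ht] at hy
  obtain ⟨v, hv, -⟩ := IsPath.exists_of_append hy
  exact ⟨v, hv⟩

end Joins

variable {φ ψ : FreeGroup (Fin m) →* FreeGroup (Fin m)}

theorem conj_mul_map_conj {p b α : FreeGroup (Fin m)} (h : b * φ α = α * b) :
    p⁻¹ * b * φ p * φ (p⁻¹ * α * p) = p⁻¹ * α * p * (p⁻¹ * b * φ p) := by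
  simp only [map_mul, map_inv, mul_assoc, mul_inv_cancel_left]
  rw [← mul_assoc b, h, mul_assoc]

/-- If translation by `α` moves a half-space into itself, then its boundary edge is fixed by every
upper triangular map which commutes with `α` and with an element not commuting with `α`. -/
theorem mul_map_eq_of_axis (hφ : IsTriangular φ) {r : ℕ} (hr : r < m)
    {α β b x : FreeGroup (Fin m)} (hα : α ∈ lower m (r + 1)) (hβ : β ∈ lower m (r + 1))
    (hb : b ∈ lower m (r + 1)) (hx : x ∈ lower m (r + 1)) (hαβ : ¬Commute α β)
    (hbα : b * φ α = α * b) (hbβ : b * φ β = β * b)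
    (h1 : x⁻¹ * (α * x) ∈ startingWith (⟨r, hr⟩ : Fin m))
    (h2 : (x⁻¹ * (α * x))⁻¹ ∉ startingWith (⟨r, hr⟩ : Fin m)) : b * φ x = x := by
  have h := (hφ.isIsometry_affine hr hb).apply_eq_self (x := ⟨x, hx⟩) (α := ⟨α, hα⟩)
    (β := ⟨β, hβ⟩) ⟨h1, h2⟩ (hφ.affine_apply_mul hb hα hbα) (hφ.affine_apply_mul hb hβ hbβ)
    (fun h => hαβ (congrArg Subtype.val h))
  exact congrArg Subtype.val h

theorem exists_common_fixed (hφ : IsTriangular φ) (hψ : IsTriangular ψ) {r : ℕ} (hr : r ≤ m)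
    {v : V} {α β b c : FreeGroup (Fin m)} (hvα : G.Joins v α v) (hvβ : G.Joins v β v)
    (hα : α ∈ lower m r) (hβ : β ∈ lower m r) (hb : b ∈ lower m r) (hc : c ∈ lower m r)
    (hαβ : ¬Commute α β) (hbα : b * φ α = α * b) (hbβ : b * φ β = β * b)
    (hcα : c * ψ α = α * c) (hcβ : c * ψ β = β * c) :
    ∃ x ∈ lower m r, (∃ w, G.Joins v x w) ∧ b * φ x = x ∧ c * ψ x = x := by
  induction r generalizing v α β b c with
  | zero =>
    have h : α = 1 := toWord_eq_nil_iff.1 (List.eq_nil_iff_forall_not_mem.2 fun l hl => by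
      simpa using hα l hl)
    exact absurd (h ▸ Commute.one_left β) hαβ
  | succ r ih =>
    rcases exists_conj_mem_or_axis (lower_succ hr ▸ hα) with
      ⟨p, hp, hpα⟩ | ⟨γ, hγ, x, hx, h1, h2⟩
    · obtain ⟨w, hw⟩ := hvα.exists_of_prefix hp
      have hpr : p ∈ lower m (r + 1) := mem_supported_of_prefix hp hα
      have hconj : ¬Commute (p⁻¹ * α * p) (p⁻¹ * β * p) := fun h => hαβ (by
        have := h.conj p
        simpa [mul_assoc] using this)
      have hα1 : p⁻¹ * α * p ≠ 1 := fun h => hconj (h ▸ Commute.one_left _)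
      have hb' := hφ.mem_lower_of_conj_of_mem_succ hr hpα hα1
        (mul_mem (mul_mem (inv_mem hpr) hb) (hφ.map_mem hpr)) (conj_mul_map_conj hbα)
      have hc' := hψ.mem_lower_of_conj_of_mem_succ hr hpα hα1
        (mul_mem (mul_mem (inv_mem hpr) hc) (hψ.map_mem hpr)) (conj_mul_map_conj hcα)
      have hwβ : G.Joins w (p⁻¹ * β * p) w := (hw.inv.mul hvβ).mul hw
      suffices h : ∃ x ∈ lower m (r + 1), (∃ w', G.Joins w x w') ∧
          p⁻¹ * b * φ p * φ x = x ∧ p⁻¹ * c * ψ p * ψ x = x by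
        obtain ⟨x, hx, ⟨w', hw'⟩, hbx, hcx⟩ := h
        refine ⟨p * x, mul_mem hpr hx, ⟨w', hw.mul hw'⟩, ?_, ?_⟩
        · rw [map_mul]
          nth_rw 2 [← hbx]
          group
        · rw [map_mul]
          nth_rw 2 [← hcx]
          group
      by_cases hpβ : p⁻¹ * β * p ∈ lower m r
      · obtain ⟨x, hx, h⟩ := ih (by omega) ((hw.inv.mul hvα).mul hw) hwβ hpα hpβ hb' hc' hconj
          (conj_mul_map_conj hbα) (conj_mul_map_conj hbβ) (conj_mul_map_conj hcα)
          (conj_mul_map_conj hcβ)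
        exact ⟨x, lower_mono r.le_succ hx, h⟩
      -- The conjugated affine maps fix the base vertex and the vertex of `p⁻¹ * β * p`.
      · obtain ⟨x, hx, hxq, h⟩ := IsTriangular.exists_first_edge_fixed hr
          (mul_mem (mul_mem (inv_mem hpr) hβ) hpr) hpβ
        exact ⟨x, hx, hwβ.exists_of_prefix hxq, h hφ hb' hb' (conj_mul_map_conj hbβ),
          h hψ hc' hc' (conj_mul_map_conj hcβ)⟩
    · have hinv : ∀ {χ : FreeGroup (Fin m) →* FreeGroup (Fin m)} {d : FreeGroup (Fin m)},
          d * χ α = α * d → d * χ γ = γ * d := by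
        intro χ d h
        rcases hγ with rfl | rfl
        · exact h
        · rw [map_inv, mul_inv_eq_iff_eq_mul, mul_assoc, h, inv_mul_cancel_left]
      have hγr : γ ∈ lower m (r + 1) := by rcases hγ with rfl | rfl <;> simpa using hα
      have hvγ : G.Joins v γ v := by
        rcases hγ with rfl | rfl
        exacts [hvα, hvα.inv]
      have hγβ : ¬Commute γ β := by rcases hγ with rfl | rfl <;> simpa using hαβ
      have hxr : x ∈ lower m (r + 1) := mem_supported_of_prefix hx hγr
      exact ⟨x, hxr, hvγ.exists_of_prefix hx,
        mul_map_eq_of_axis hφ hr hγr hβ hb hxr hγβ (hinv hbα) hbβ h1 h2,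
        mul_map_eq_of_axis hψ hr hγr hβ hc hxr hγβ (hinv hcα) hcβ h1 h2⟩

namespace Path

variable {u w : V}

theorem Homotopic.mk_eq {p q : G.Path u w} (h : p.Homotopic q) :
    FreeGroup.mk p.edges = FreeGroup.mk q.edges := by
  induction h with
  | rel _ _ h => exact Quot.sound h
  | refl _ => rfl
  | symm _ _ _ ih => exact ih.symm
  | trans _ _ _ _ _ ih ih' => exact ih.trans ih'

theorem homotopic_of_red {p q : G.Path u w} (h : Red p.edges q.edges) : p.Homotopic q := by
  obtain ⟨L, hL⟩ := p
  obtain ⟨L', hL'⟩ := q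
  change Red L L' at h
  induction h with
  | refl => exact .refl _
  | tail h' h ih => exact .trans _ _ _ (ih (hL.of_red h')) (.rel _ _ h)

/-- Free reduction keeps an edge path an edge path with the same end points, so both paths are
homotopic to one reduced path. -/
theorem homotopic_iff {p q : G.Path u w} :
    p.Homotopic q ↔ FreeGroup.mk p.edges = FreeGroup.mk q.edges := by
  refine ⟨Homotopic.mk_eq, fun h => ?_⟩
  have hp : p.Homotopic ⟨reduce p.edges, p.isPath.of_red reduce.red⟩ :=
    homotopic_of_red reduce.red
  have hq : q.Homotopic ⟨reduce q.edges, q.isPath.of_red reduce.red⟩ :=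
    homotopic_of_red reduce.red
  have hpq : (⟨reduce p.edges, p.isPath.of_red reduce.red⟩ : G.Path u w) =
      ⟨reduce q.edges, q.isPath.of_red reduce.red⟩ := Path.ext (reduce.sound h)
  exact .trans _ _ _ (hpq ▸ hp) (.symm _ _ hq)

theorem height_le_iff {p : G.Path u w} {n : ℕ} :
    p.height ≤ n ↔ ∀ e ∈ p.edges, (e.1 : ℕ) < n := by
  unfold height
  induction p.edges with
  | nil => simp
  | cons e L ih => simp [ih]

end Path

namespace Map

/-- The endomorphism of the free group on the edges induced by a map of graphs. -/
def hom (f : G.Map) : FreeGroup (Fin m) →* FreeGroup (Fin m) :=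
  lift fun i => FreeGroup.mk (f.edge i).edges

theorem hom_mk (f : G.Map) (p : List (Fin m × Bool)) :
    f.hom (FreeGroup.mk p) = FreeGroup.mk (p.flatMap f.orientedEdge) := by
  induction p with
  | nil => exact map_one _
  | cons e p ih =>
    rw [List.flatMap_cons, ← mul_mk, ← ih, ← List.singleton_append, ← mul_mk, map_mul]
    congr 1
    obtain ⟨i, b⟩ := e
    cases b <;> simp [hom, orientedEdge, Path.reverse, inv_mk]

namespace IsUpperTriangular

variable {f : G.Map}

theorem isTriangular_hom (hf : f.IsUpperTriangular) : IsTriangular f.hom := fun i => by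
  obtain ⟨u, hu, h⟩ := hf i
  refine ⟨FreeGroup.mk u.edges, mk_mem_supported fun l hl => hu l hl, ?_⟩
  rw [hom, lift_apply_of, h, ← List.singleton_append, ← mul_mk]
  rfl

theorem vert_init (hf : f.IsUpperTriangular) (i : Fin m) : f.vert (G.init i) = G.init i := by
  obtain ⟨u, -, h⟩ := hf i
  have hp := (f.edge i).isPath
  rw [h] at hp
  exact hp.1.symm

theorem vert_term (hf : f.IsUpperTriangular) (i : Fin m) : f.vert (G.term i) = G.term i := by
  obtain ⟨u, -, h⟩ := hf i
  have hp := (f.edge i).isPath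
  rw [h] at hp
  have huniq : ∀ {L : List (Fin m × Bool)} {a b c : V}, G.IsPath a L b → G.IsPath a L c →
      b = c := by
    intro L a b c hb hc
    induction L generalizing a with
    | nil => exact hb.symm.trans hc
    | cons e L ih => exact ih hb.2 hc.2
  exact huniq hp.2 u.isPath

theorem vert_of_isPath (hf : f.IsUpperTriangular) {u w : V} {p : List (Fin m × Bool)}
    (hp : G.IsPath u p w) (hne : p ≠ []) : f.vert u = u := by
  cases p with
  | nil => exact absurd rfl hne
  | cons e p =>
    obtain ⟨⟨i, b⟩, p⟩ := e, p
    obtain ⟨rfl, -⟩ := hp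
    cases b
    · exact hf.vert_term i
    · exact hf.vert_init i

end IsUpperTriangular

theorem inv_mk_mul_hom_mk (f : G.Map) {v : V} {α : G.Path v v} {μ : G.Path (f.vert v) v}
    (h : (f.mapPath α).Homotopic ((μ.append α).append μ.reverse)) :
    (FreeGroup.mk μ.edges)⁻¹ * f.hom (FreeGroup.mk α.edges) =
      FreeGroup.mk α.edges * (FreeGroup.mk μ.edges)⁻¹ := by
  have h' := h.mk_eq
  simp only [mapPath, Path.append, Path.reverse, ← mul_mk, ← inv_mk] at h'
  rw [hom_mk, h']
  group

end Map

theorem not_commute_of_closure_equiv {H : Type*} [Group H] {a : Fin 2 → H}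
    (h : Nonempty (Subgroup.closure (Set.range a) ≃* FreeGroup (Fin 2))) :
    ¬Commute (a 0) (a 1) := by
  obtain ⟨e⟩ := h
  intro hc
  have hcomm : ∀ x ∈ Set.range a, ∀ y ∈ Set.range a, x * y = y * x := by
    rintro _ ⟨i, rfl⟩ _ ⟨j, rfl⟩
    fin_cases i <;> fin_cases j
    exacts [rfl, hc, hc.symm, rfl]
  have hK := Subgroup.isMulCommutative_closure hcomm
  have h01 : (of 0 * of 1 : FreeGroup (Fin 2)) = of 1 * of 0 := by
    apply e.symm.injective
    rw [map_mul, map_mul]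
    exact hK.is_comm.comm _ _
  have := congrArg toWord h01
  revert this
  decide

end FilteredGraph

theorem mainTheorem5 {V : Type*} {m : ℕ} (G : FilteredGraph V m) (f g : G.Map)
    (hf : f.IsUpperTriangular) (hg : g.IsUpperTriangular)
    (v : V) (α : Fin 2 → G.Path v v)
    (hα : Nonempty
      (Subgroup.closure (Set.range fun i => FilteredGraph.FundamentalGroup.mk (α i)) ≃*
        FreeGroup (Fin 2)))
    (μ : G.Path (f.vert v) v) (ν : G.Path (g.vert v) v)
    (hμ : ∀ i, (f.mapPath (α i)).Homotopic ((μ.append (α i)).append μ.reverse))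
    (hν : ∀ i, (g.mapPath (α i)).Homotopic ((ν.append (α i)).append ν.reverse)) :
    ∃ (w : V) (δ : G.Path w v) (hfw : f.vert w = w) (hgw : g.vert w = w),
      ((f.mapPath δ).copy hfw rfl).Homotopic (δ.append μ.reverse) ∧
      ((g.mapPath δ).copy hgw rfl).Homotopic (δ.append ν.reverse) ∧
      δ.height ≤ max (α 0).height (α 1).height := by
  set a := fun i => FreeGroup.mk (α i).edges with ha
  have hcomm : ¬Commute (a 0) (a 1) := fun h => by
    refine FilteredGraph.not_commute_of_closure_equiv hα ?_
    refine Quotient.sound (s := FilteredGraph.Path.setoid G v v)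
      (FilteredGraph.Path.homotopic_iff.2 ?_)
    simpa only [ha, FilteredGraph.Path.append, ← FreeGroup.mul_mk] using h.eq
  -- Needed if `δ` is trivial: then `w = v`, which is fixed as an end point of an edge of `α 0`.
  have hne : (α 0).edges ≠ [] := fun h => hcomm (by
    have h1 : a 0 = 1 := by simp only [ha, h]; rfl
    exact h1 ▸ Commute.one_left _)
  set r := max (α 0).height (α 1).height
  have hpos : ∀ i, (α i).height ≤ r := fun i => by fin_cases i <;> simp [r]
  have hmem : ∀ i, a i ∈ FreeGroup.lower m r := fun i =>
    FreeGroup.mk_mem_supported (FilteredGraph.Path.height_le_iff.1 (hpos i))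
  have hrm : r ≤ m := max_le (FilteredGraph.Path.height_le_iff.2 fun e _ => e.1.2)
    (FilteredGraph.Path.height_le_iff.2 fun e _ => e.1.2)
  have ha1 : a 0 ≠ 1 := fun h => hcomm (h ▸ Commute.one_left _)
  have hb := fun i => f.inv_mk_mul_hom_mk (hμ i)
  have hc := fun i => g.inv_mk_mul_hom_mk (hν i)
  have hjoin : ∀ i, G.Joins v (a i) v := fun i => FilteredGraph.joins_mk (α i).isPath
  have hφ := hf.isTriangular_hom
  have hψ := hg.isTriangular_hom
  obtain ⟨x, hx, ⟨w, hw⟩, hfx, hgx⟩ := FilteredGraph.exists_common_fixed hφ hψ hrm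
    (hjoin 0) (hjoin 1) (hmem 0) (hmem 1) (hφ.mem_lower_of_conj hrm (hmem 0) ha1 (hb 0))
    (hψ.mem_lower_of_conj hrm (hmem 0) ha1 (hc 0)) hcomm (hb 0) (hb 1) (hc 0) (hc 1)
  -- Inverting `φ x = [μ] x` gives `φ δ = δ [μ]⁻¹`.
  let δ : G.Path w v := ⟨x⁻¹.toWord, hw.inv⟩
  have hvert : ∀ {k : G.Map}, k.IsUpperTriangular → k.vert w = w := fun hk => by
    by_cases h : x⁻¹.toWord = []
    · have hwv : w = v := by
        have h' := δ.isPath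
        rwa [show δ.edges = [] from h] at h'
      rw [hwv]
      exact hk.vert_of_isPath (α 0).isPath hne
    · exact hk.vert_of_isPath δ.isPath h
  have hδ : ∀ {k : G.Map} (hk : k.IsUpperTriangular) {κ : G.Path (k.vert v) v},
      (FreeGroup.mk κ.edges)⁻¹ * k.hom x = x →
        ((k.mapPath δ).copy (hvert hk) rfl).Homotopic (δ.append κ.reverse) := by
    intro k hk κ h
    rw [FilteredGraph.Path.homotopic_iff]
    change FreeGroup.mk (x⁻¹.toWord.flatMap k.orientedEdge) =
      FreeGroup.mk (x⁻¹.toWord ++ FreeGroup.invRev κ.edges)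
    rw [← k.hom_mk, ← FreeGroup.mul_mk, ← FreeGroup.inv_mk, FreeGroup.mk_toWord, map_inv]
    nth_rw 2 [← h]
    group
  exact ⟨w, δ, hvert hf, hvert hg, hδ hf hfx, hδ hg hgx,
    FilteredGraph.Path.height_le_iff.2 (FreeGroup.mem_supported.1 (inv_mem hx))⟩
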